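/- Classes are subcollections of the universe $V$ of all sets. For a linear order $\ell$, an $\ell$-graded digraph is a collection of nodes with a binary edge relation $\rightharpoonup$ and an assignment of a value in $\ell$ to each node, such that the value of $a$ is strictly less than the value of $b$ whenever $a\rightharpoonup b$. Isomorphisms and embeddings (onto induced subgraphs) of graded digraphs preserve and reflect edges and preserve the values of nodes. Surreal numbers are represented by terms $\{A\mid B\}$, where $A$ and $B$ are sets of previously constructed terms such that every $a\in A$ and $b\in B$ satisfy $a<b$. The order on terms is given recursively: for $x=\{X_L\mid X_R\}$ and $y=\{Y_L\mid Y_R\}$, $x\le y$ holds if and only if there is no $x_L\in X_L$ with $y\le x_L$ and no $y_R\in Y_R$ with $y_R\le x$; and $x<y$ means that $x\le y$ and not $y\le x$. The class $\mathrm{No}$ of surreal numbers, considered as a linear order, is the quotient of the class of terms by the equivalence $x\le y\le x$. Let $\mathrm{Hg}$ (the hypnagogic digraph) be the $\mathrm{No}$-graded class digraph whose nodes are all the terms $\{A\mid B\}$, not quotiented by the equivalence, where $v=\{A\mid B\}$ has edges $a\rightharpoonup v$ for $a\in A$ and $v\rightharpoonup b$ for $b\in B$, and where the value of $v$ is the surreal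 number that it represents. **Theorem.** 1. $\mathrm{Hg}$ is universal for all set graded digraphs using any linear order as a suborder of $\mathrm{No}$: every set linear order embeds in $\mathrm{No}$, and for every suborder $\ell\subseteq\mathrm{No}$, every set $\ell$-graded digraph embeds in $\mathrm{Hg}$. 2. $\mathrm{Hg}$ is set-homogeneous: every isomorphism between two set-sized induced graded subgraphs of $\mathrm{Hg}$ extends to an automorphism of $\mathrm{Hg}$. 3. If global choice holds, then $\mathrm{Hg}$ is universal for all class graded digraphs using any class linear order as a suborder of $\mathrm{No}$: every class linear order embeds in $\mathrm{No}$, and for every suborder $\ell\subseteq\mathrm{No}$, every class $\ell$-graded digraph embeds in $\mathrm{Hg}$. Furthermore, $\mathrm{Hg}$ is determined up to isomorphism by (1) and (2): every $\mathrm{No}$-graded class digraph that is set-homogeneous and in which, for every suborder $\ell\subseteq\mathrm{No}$, every set $\ell$-graded digraph embeds is isomorphic to $\mathrm{Hg}$. 4. $\mathrm{Hg}$ has the set-pattern property: for all pairwise disjoint sets $A,B,C$ of nodes and all $\alpha\in\mathrm{No}$ such that every node in $A$ has value less than $\alpha$ and every node in $B$ has value greater than $\alpha$, there is a node $v$ with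 value exactly $\alpha$ such that $a\rightharpoonup v$ and $v\rightharpoonup b$ for all $a\in A$ and $b\in B$, and $v$ has no edges, in either direction, with any node in $C$. -/

import Mathlib

/-!
Sets and classes. For a fixed universe `u`, the sets are the elements of `ZFSet.{u}` and the classes
are the arbitrary subcollections of `ZFSet.{u}`. Up to bijection, a set is a type in `Type u` (or a
`Small.{u}` type), and a class is a type that injects into `ZFSet.{u}`.
-/

universe u v w

namespace Hypnagogic

/-- The type `α` is in bijection with a class, that is, with a subcollection of `ZFSet.{u}`. -/
def IsClassSized (α : Type v) : Prop :=
  Nonempty (α ↪ ZFSet.{u})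

/-- Global choice: there is a class function that chooses an element from every nonempty set. -/
def GlobalChoice : Prop :=
  ∃ F : ZFSet.{u} → ZFSet.{u}, ∀ x : ZFSet.{u}, x.Nonempty → F x ∈ x

/-! ### Left-set/right-set representations `{A | B}` and their order -/

/-- The members of the left set of `x = {A | B}`, which is coded as the ordered pair `(A, B)`. -/
def leftSet (x : ZFSet.{u}) : Set ZFSet.{u} :=
  {a | ∃ A B : ZFSet.{u}, x = ZFSet.pair A B ∧ a ∈ A}

/-- The members of the right set of `x = {A | B}`. -/
def rightSet (x : ZFSet.{u}) : Set ZFSet.{u} :=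
  {b | ∃ A B : ZFSet.{u}, x = ZFSet.pair A B ∧ b ∈ B}

@[simp] theorem mem_leftSet_pair {A B a : ZFSet.{u}} : a ∈ leftSet (ZFSet.pair A B) ↔ a ∈ A := by
  constructor
  · rintro ⟨A', B', h, ha⟩
    rw [ZFSet.pair_inj] at h
    rwa [h.1]
  · intro h
    exact ⟨A, B, rfl, h⟩

@[simp] theorem mem_rightSet_pair {A B b : ZFSet.{u}} : b ∈ rightSet (ZFSet.pair A B) ↔ b ∈ B := by
  constructor
  · rintro ⟨A', B', h, hb⟩
    rw [ZFSet.pair_inj] at h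
    rwa [h.2]
  · intro h
    exact ⟨A, B, rfl, h⟩

/-- `a` is a member of the left set or of the right set of `x`. -/
def IsOption (a x : ZFSet.{u}) : Prop :=
  a ∈ leftSet x ∨ a ∈ rightSet x

theorem IsOption.rank_lt {a x : ZFSet.{u}} (h : IsOption a x) : a.rank < x.rank := by
  rcases h with ⟨A, B, rfl, h⟩ | ⟨A, B, rfl, h⟩
  · have h1 : A ∈ ({A} : ZFSet.{u}) := by simp
    have h2 : ({A} : ZFSet.{u}) ∈ ZFSet.pair A B := by simp [ZFSet.pair]
    exact (ZFSet.rank_lt_of_mem h).trans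
      ((ZFSet.rank_lt_of_mem h1).trans (ZFSet.rank_lt_of_mem h2))
  · have h1 : B ∈ ({A, B} : ZFSet.{u}) := by simp
    have h2 : ({A, B} : ZFSet.{u}) ∈ ZFSet.pair A B := by simp [ZFSet.pair]
    exact (ZFSet.rank_lt_of_mem h).trans
      ((ZFSet.rank_lt_of_mem h1).trans (ZFSet.rank_lt_of_mem h2))

theorem isOption_wf : WellFounded (IsOption.{u}) :=
  Subrelation.wf (fun h => IsOption.rank_lt h) (InvImage.wf ZFSet.rank Ordinal.lt_wf)

/-- The recursive definition of the order on representations; it is characterized by `le_iff`. -/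
def le (x y : ZFSet.{u}) : Prop :=
  Sym2.GameAdd.recursion (C := fun _ _ => Prop) isOption_wf
    (fun x y IH =>
      (∀ (a : ZFSet.{u}) (h : a ∈ leftSet x), ¬ IH y a (Sym2.GameAdd.snd_fst (Or.inl h))) ∧
      (∀ (b : ZFSet.{u}) (h : b ∈ rightSet y), ¬ IH b x (Sym2.GameAdd.fst_snd (Or.inr h)))) x y

/-- `x ≤ y` if and only if there is no `a` in the left set of `x` with `y ≤ a` and no `b` in the
right set of `y` with `b ≤ x`. -/
theorem le_iff {x y : ZFSet.{u}} :
    le x y ↔ (∀ a ∈ leftSet x, ¬ le y a) ∧ (∀ b ∈ rightSet y, ¬ le b x) := by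
  unfold le
  rw [Sym2.GameAdd.recursion_eq]

theorem le_refl (x : ZFSet.{u}) : le x x := by
  induction x using isOption_wf.induction with
  | _ x ih =>
    rw [le_iff]
    exact ⟨fun a ha h => (le_iff.1 h).1 a ha (ih a (Or.inl ha)),
      fun b hb h => (le_iff.1 h).2 b hb (ih b (Or.inr hb))⟩

theorem le_trans_aux (x : ZFSet.{u}) : ∀ y z : ZFSet.{u},
    (le x y → le y z → le x z) ∧ (le y z → le z x → le y x) ∧ (le z x → le x y → le z y) := by
  induction x using isOption_wf.induction with
  | _ x ihx =>
  intro y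
  induction y using isOption_wf.induction with
  | _ y ihy =>
  intro z
  induction z using isOption_wf.induction with
  | _ z ihz =>
  refine ⟨fun h1 h2 => ?_, fun h1 h2 => ?_, fun h1 h2 => ?_⟩
  · refine le_iff.2 ⟨fun a ha h => ?_, fun b hb h => ?_⟩
    · exact (le_iff.1 h1).1 a ha ((ihx a (Or.inl ha) y z).2.1 h2 h)
    · exact (le_iff.1 h2).2 b hb ((ihz b (Or.inr hb)).2.2 h h1)
  · refine le_iff.2 ⟨fun a ha h => ?_, fun b hb h => ?_⟩
    · exact (le_iff.1 h1).1 a ha ((ihy a (Or.inl ha) z).2.2 h2 h)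
    · exact (le_iff.1 h2).2 b hb ((ihx b (Or.inr hb) y z).1 h h1)
  · refine le_iff.2 ⟨fun a ha h => ?_, fun b hb h => ?_⟩
    · exact (le_iff.1 h1).1 a ha ((ihz a (Or.inl ha)).1 h2 h)
    · exact (le_iff.1 h2).2 b hb ((ihy b (Or.inr hb) z).2.1 h h1)

theorem le_trans {x y z : ZFSet.{u}} (h1 : le x y) (h2 : le y z) : le x z :=
  (le_trans_aux x y z).1 h1 h2

/-- `x` is a representation `{A | B}` of a surreal number: `A` and `B` are sets of previously
constructed representations, and every number in `A` is smaller than every number in `B`. -/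
inductive IsRep : ZFSet.{u} → Prop
  | mk (A B : ZFSet.{u}) (hA : ∀ a ∈ A, IsRep a) (hB : ∀ b ∈ B, IsRep b)
      (hAB : ∀ a ∈ A, ∀ b ∈ B, le a b ∧ ¬ le b a) : IsRep (ZFSet.pair A B)

theorem IsRep.left {x a : ZFSet.{u}} (hx : IsRep x) (ha : a ∈ leftSet x) : IsRep a := by
  cases hx with
  | mk A B hA hB hAB => exact hA a (mem_leftSet_pair.1 ha)

theorem IsRep.right {x b : ZFSet.{u}} (hx : IsRep x) (hb : b ∈ rightSet x) : IsRep b := by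
  cases hx with
  | mk A B hA hB hAB => exact hB b (mem_rightSet_pair.1 hb)

theorem IsRep.left_right {x a b : ZFSet.{u}} (hx : IsRep x) (ha : a ∈ leftSet x)
    (hb : b ∈ rightSet x) : le a b ∧ ¬ le b a := by
  cases hx with
  | mk A B hA hB hAB => exact hAB a (mem_leftSet_pair.1 ha) b (mem_rightSet_pair.1 hb)

theorem not_le_left {x a : ZFSet.{u}} (ha : a ∈ leftSet x) : ¬ le x a :=
  (le_iff.1 (le_refl x)).1 a ha

theorem not_right_le {x b : ZFSet.{u}} (hb : b ∈ rightSet x) : ¬ le b x :=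
  (le_iff.1 (le_refl x)).2 b hb

theorem IsRep.options_le {x : ZFSet.{u}} (hx : IsRep x) :
    (∀ a ∈ leftSet x, le a x) ∧ (∀ b ∈ rightSet x, le x b) := by
  induction x using isOption_wf.induction with
  | _ x ih =>
  refine ⟨fun a ha => le_iff.2 ⟨fun a' ha' h => ?_, fun b hb => (hx.left_right ha hb).2⟩,
    fun b hb => le_iff.2 ⟨fun a ha => (hx.left_right ha hb).2, fun b' hb' h => ?_⟩⟩
  · exact not_le_left ha (le_trans h ((ih a (Or.inl ha) (hx.left ha)).1 a' ha'))
  · exact not_right_le hb (le_trans ((ih b (Or.inr hb) (hx.right hb)).2 b' hb') h)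

theorem IsRep.le_total {x y : ZFSet.{u}} (hx : IsRep x) (hy : IsRep y) : le x y ∨ le y x := by
  by_cases h : le x y
  · exact Or.inl h
  · right
    rw [le_iff, not_and_or] at h
    push Not at h
    rcases h with ⟨a, ha, h⟩ | ⟨b, hb, h⟩
    · exact le_trans h (hx.options_le.1 a ha)
    · exact le_trans (hy.options_le.2 b hb) h

/-- The representations `{A | B}` of surreal numbers, different representations of the same number
being different elements. -/
def Rep : Type (u + 1) :=
  {x : ZFSet.{u} // IsRep x}

instance : Preorder Rep.{u} where
  le x y := le x.1 y.1
  le_refl x := le_refl x.1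
  le_trans _ _ _ h1 h2 := le_trans h1 h2

/-- The class of surreal numbers: representations modulo the equivalence `x ≤ y ≤ x`. -/
def No : Type (u + 1) :=
  Antisymmetrization Rep.{u} (· ≤ ·)

/-- The surreal number represented by `x`. -/
def Rep.value (x : Rep.{u}) : No.{u} :=
  toAntisymmetrization (· ≤ ·) x

instance : PartialOrder No.{u} :=
  inferInstanceAs (PartialOrder (Antisymmetrization Rep.{u} (· ≤ ·)))

theorem No.le_total (x y : No.{u}) : x ≤ y ∨ y ≤ x :=
  Quotient.inductionOn₂' x y fun a b => IsRep.le_total a.2 b.2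

open Classical in
noncomputable instance : LinearOrder No.{u} where
  le_total := No.le_total
  toDecidableLE := inferInstance

theorem Rep.value_lt_value {x y : Rep.{u}} :
    x.value < y.value ↔ le x.1 y.1 ∧ ¬ le y.1 x.1 :=
  Iff.rfl

/-! ### Graded digraphs -/

/-- An `ℓ`-graded digraph: a binary relation on a collection of nodes, each of which is assigned a
value in the linear order `ℓ`, such that values increase strictly along edges. -/
structure GradedDigraph (ℓ : Type w) [LinearOrder ℓ] where
  /-- The nodes. -/
  V : Type v
  /-- `Adj a b` means that there is an edge pointing from `a` to `b`. -/
  Adj : V → V → Prop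
  /-- The value of a node. -/
  val : V → ℓ
  val_lt : ∀ {a b : V}, Adj a b → val a < val b

namespace GradedDigraph

variable {ℓ : Type w} [LinearOrder ℓ]

/-- The induced graded subgraph on a collection `S` of nodes. -/
def induce (G : GradedDigraph.{v} ℓ) (S : Set G.V) : GradedDigraph.{v} ℓ where
  V := S
  Adj a b := G.Adj a b
  val a := G.val a
  val_lt h := G.val_lt h

/-- Isomorphisms of `ℓ`-graded digraphs: they respect the edge relation and the values. -/
structure Iso (G : GradedDigraph.{v} ℓ) (H : GradedDigraph.{v} ℓ) where
  toEquiv : G.V ≃ H.V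
  adj_iff : ∀ a b : G.V, H.Adj (toEquiv a) (toEquiv b) ↔ G.Adj a b
  val_eq : ∀ a : G.V, H.val (toEquiv a) = G.val a

/-- For a suborder `s` of `ℓ`, an embedding of an `s`-graded digraph as an induced subgraph of an
`ℓ`-graded digraph, respecting the values. -/
structure Embedding {s : Set ℓ} (G : GradedDigraph.{v} s) (H : GradedDigraph.{u} ℓ) where
  toFun : G.V → H.V
  injective : Function.Injective toFun
  adj_iff : ∀ a b : G.V, H.Adj (toFun a) (toFun b) ↔ G.Adj a b
  val_eq : ∀ a : G.V, H.val (toFun a) = (G.val a : ℓ)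

end GradedDigraph

/-- `H` is universal for all set-sized digraphs that are graded by a suborder of `No`. -/
def SetUniversal (H : GradedDigraph.{u + 1} No.{u}) : Prop :=
  ∀ (s : Set No.{u}) (G : GradedDigraph.{u} s), Nonempty (G.Embedding H)

/-- `H` is universal for all class digraphs that are graded by a suborder of `No`. -/
def ClassUniversal (H : GradedDigraph.{u + 1} No.{u}) : Prop :=
  ∀ (s : Set No.{u}) (G : GradedDigraph.{u + 1} s), IsClassSized.{u} G.V →
    Nonempty (G.Embedding H)

/-- Any isomorphism of two set-sized induced graded subgraphs of `H` extends to an automorphism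
of `H`. -/
def SetHomogeneous (H : GradedDigraph.{u + 1} No.{u}) : Prop :=
  ∀ (S T : Set H.V) [Small.{u} S] [Small.{u} T] (f : (H.induce S).Iso (H.induce T)),
    ∃ F : H.Iso H, ∀ x : S, F.toEquiv x.1 = (f.toEquiv x : T).1

/-- The set-pattern property: for all disjoint sets `A`, `B`, `C` of nodes and all `α` such that the
nodes in `A` have value less than `α` and those in `B` have value greater than `α`, there is a node
with value `α` that is pointed at from every node in `A`, points at every node in `B`, and has
no edges with any node in `C`. -/
def SetPattern (H : GradedDigraph.{u + 1} No.{u}) : Prop :=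
  ∀ (A B C : Set H.V) [Small.{u} A] [Small.{u} B] [Small.{u} C] (α : No.{u}),
    Disjoint A B → Disjoint A C → Disjoint B C →
    (∀ a ∈ A, H.val a < α) → (∀ b ∈ B, α < H.val b) →
    ∃ v : H.V, H.val v = α ∧ (∀ a ∈ A, H.Adj a v) ∧ (∀ b ∈ B, H.Adj v b) ∧
      ∀ c ∈ C, ¬ H.Adj c v ∧ ¬ H.Adj v c

/-- The hypnagogic digraph: the nodes are the representations `{A | B}`, the node `v = {A | B}` has
edges `a → v` and `v → b` for all `a ∈ A` and `b ∈ B`, and the value of `v` is the surreal number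
that it represents. -/
def Hg : GradedDigraph.{u + 1} No.{u} where
  V := Rep.{u}
  Adj x y := x.1 ∈ leftSet y.1 ∨ y.1 ∈ rightSet x.1
  val := Rep.value
  val_lt := by
    intro x y h
    rw [Rep.value_lt_value]
    rcases h with h | h
    · exact ⟨y.2.options_le.1 _ h, not_le_left h⟩
    · exact ⟨x.2.options_le.2 _ h, not_right_le h⟩

end Hypnagogic

/-! As for the random graph, everything follows from one extension property, `SetExtension`: over a
small set `S` of nodes, there is a node outside `S` with prescribed value and exactly prescribed
edges to `S`, as long as the values permit those edges.

`Hg` has it because a number has many representations (`Rep.exists_value_eq_of_subset`). Take any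
`x` of value `α`, replace its options by copies of equal value whose rank is too high for them to
lie in `S`, and add `A` on the left and `B` on the right. These lie on the correct sides of `x`, so
the value stays `α`. One more huge right option lifts the rank of the new node above `S`, so it is
not an option of any node in `S`.

Classes can be well-ordered with small initial segments, so a transfinite construction meets only
small partial maps. Going forth with the extension property gives universality; going back and forth
gives homogeneity and uniqueness (`SetExtension.exists_iso`). Conversely, universality and
homogeneity imply the extension property (`SetUniversal.setExtension`), so they determine the
digraph. Embedding linear orders in `No` is the same forth argument, with `{A | B}` filling each
cut. -/

namespace Hypnagogic

/-! ### Options of representations and the simplicity principle -/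

namespace Rep

/-- The left options of a representation. -/
def left (x : Rep.{u}) : Set Rep.{u} :=
  {a | a.1 ∈ leftSet x.1}

/-- The right options of a representation. -/
def right (x : Rep.{u}) : Set Rep.{u} :=
  {b | b.1 ∈ rightSet x.1}

theorem value_lt_of_mem_left {x a : Rep.{u}} (h : a ∈ x.left) : a.value < x.value :=
  ⟨x.2.options_le.1 _ h, not_le_left h⟩

theorem value_lt_of_mem_right {x b : Rep.{u}} (h : b ∈ x.right) : x.value < b.value :=
  ⟨x.2.options_le.2 _ h, not_right_le h⟩

theorem rank_lt_of_mem_left {x a : Rep.{u}} (h : a ∈ x.left) : a.1.rank < x.1.rank :=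
  IsOption.rank_lt (Or.inl h)

theorem rank_lt_of_mem_right {x b : Rep.{u}} (h : b ∈ x.right) : b.1.rank < x.1.rank :=
  IsOption.rank_lt (Or.inr h)

/-- The negations in the recursive clause can become strict inequalities because options lie
strictly to either side of the number they define. -/
theorem value_le_iff {x y : Rep.{u}} : x.value ≤ y.value ↔
    (∀ a ∈ x.left, a.value < y.value) ∧ (∀ b ∈ y.right, x.value < b.value) := by
  refine ⟨fun h => ⟨fun a ha => (value_lt_of_mem_left ha).trans_le h,
    fun b hb => h.trans_lt (value_lt_of_mem_right hb)⟩, fun h => ?_⟩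
  refine le_iff.2 ⟨fun a ha h' => ?_, fun b hb h' => ?_⟩
  · exact (h.1 ⟨a, x.2.left ha⟩ ha).not_ge h'
  · exact (h.2 ⟨b, y.2.right hb⟩ hb).not_ge h'

/-- A representation `y` all of whose options lie on the correct side of `x`, and whose options are
cofinal with those of `x`, represents the same number as `x`. -/
theorem value_eq_of_cofinal {x y : Rep.{u}} (hl : ∀ a ∈ y.left, a.value < x.value)
    (hr : ∀ b ∈ y.right, x.value < b.value)
    (hl' : ∀ a ∈ x.left, ∃ a' ∈ y.left, a.value ≤ a'.value)
    (hr' : ∀ b ∈ x.right, ∃ b' ∈ y.right, b'.value ≤ b.value) : y.value = x.value := by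
  refine le_antisymm (value_le_iff.2 ⟨hl, fun b hb => ?_⟩) (value_le_iff.2 ⟨fun a ha => ?_, hr⟩)
  · obtain ⟨b', hb', h⟩ := hr' b hb
    exact (value_lt_of_mem_right hb').trans_le h
  · obtain ⟨a', ha', h⟩ := hl' a ha
    exact h.trans_lt (value_lt_of_mem_left ha')

/-- The representation `{A | B}` for small sets `A < B` of representations. -/
theorem exists_left_right (A B : Set Rep.{u}) [Small.{u} A] [Small.{u} B]
    (h : ∀ a ∈ A, ∀ b ∈ B, a.value < b.value) : ∃ x : Rep.{u}, x.left = A ∧ x.right = B := by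
  let A' : ZFSet.{u} := ZFSet.range fun a : A => a.1.1
  let B' : ZFSet.{u} := ZFSet.range fun b : B => b.1.1
  have hA : ∀ a, a ∈ A' ↔ ∃ y ∈ A, y.1 = a := fun a => by simp [A', ZFSet.mem_range]
  have hB : ∀ b, b ∈ B' ↔ ∃ y ∈ B, y.1 = b := fun b => by simp [B', ZFSet.mem_range]
  refine ⟨⟨ZFSet.pair A' B', IsRep.mk _ _ ?_ ?_ ?_⟩, ?_, ?_⟩
  · intro a ha
    obtain ⟨y, -, rfl⟩ := (hA a).1 ha
    exact y.2
  · intro b hb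
    obtain ⟨y, -, rfl⟩ := (hB b).1 hb
    exact y.2
  · intro a ha b hb
    obtain ⟨y, hy, rfl⟩ := (hA a).1 ha
    obtain ⟨z, hz, rfl⟩ := (hB b).1 hb
    exact h y hy z hz
  · ext a
    simp only [left, Set.mem_ofPred_eq, mem_leftSet_pair, hA]
    exact ⟨fun ⟨y, hy, h⟩ => Subtype.ext h ▸ hy, fun ha => ⟨a, ha, rfl⟩⟩
  · ext b
    simp only [right, Set.mem_ofPred_eq, mem_rightSet_pair, hB]
    exact ⟨fun ⟨y, hy, h⟩ => Subtype.ext h ▸ hy, fun hb => ⟨b, hb, rfl⟩⟩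

theorem small_of_forall_mem {S : Set Rep.{u}} (z : ZFSet.{u}) (h : ∀ x ∈ S, x.1 ∈ z) :
    Small.{u} S :=
  small_of_injective (β := z) (f := fun x => ⟨x.1.1, h x.1 x.2⟩) fun _ _ hxy =>
    Subtype.ext (Subtype.ext (Subtype.mk.inj hxy))

instance small_left (x : Rep.{u}) : Small.{u} x.left := by
  obtain ⟨_, A, B, -, -, -⟩ := x
  exact small_of_forall_mem A fun a ha => mem_leftSet_pair.1 ha

instance small_right (x : Rep.{u}) : Small.{u} x.right := by
  obtain ⟨_, A, B, -, -, -⟩ := x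
  exact small_of_forall_mem B fun b hb => mem_rightSet_pair.1 hb

theorem exists_value_eq (α : No.{u}) : ∃ x : Rep.{u}, x.value = α :=
  Quotient.exists_rep α

end Rep

/-- Small sets `A < B` of surreal numbers are separated by a surreal number. -/
theorem No.exists_between (A B : Set No.{u}) [Small.{u} A] [Small.{u} B]
    (h : ∀ a ∈ A, ∀ b ∈ B, a < b) : ∃ x : No.{u}, (∀ a ∈ A, a < x) ∧ ∀ b ∈ B, x < b := by
  choose f hf using Rep.exists_value_eq.{u}
  obtain ⟨x, hl, hr⟩ := Rep.exists_left_right (f '' A) (f '' B) (by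
    rintro _ ⟨a, ha, rfl⟩ _ ⟨b, hb, rfl⟩
    simpa only [hf] using h a ha b hb)
  refine ⟨x.value, fun a ha => ?_, fun b hb => ?_⟩
  · have : f a ∈ x.left := hl ▸ Set.mem_image_of_mem f ha
    simpa only [hf] using Rep.value_lt_of_mem_left this
  · have : f b ∈ x.right := hr ▸ Set.mem_image_of_mem f hb
    simpa only [hf] using Rep.value_lt_of_mem_right this

/-! ### The extension property -/

/-- A form of the set-pattern property that yields a new node: the edges between the new node and
a small set `S` of nodes are prescribed by subsets `A` and `B` of `S`. -/
def SetExtension (H : GradedDigraph.{u + 1} No.{u}) : Prop :=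
  ∀ (S A B : Set H.V) [Small.{u} S] (α : No.{u}), A ⊆ S → B ⊆ S →
    (∀ a ∈ A, H.val a < α) → (∀ b ∈ B, α < H.val b) →
    ∃ v : H.V, v ∉ S ∧ H.val v = α ∧ ∀ s ∈ S, (H.Adj s v ↔ s ∈ A) ∧ (H.Adj v s ↔ s ∈ B)

theorem SetExtension.setPattern {H : GradedDigraph.{u + 1} No.{u}} (h : SetExtension H) :
    SetPattern H := by
  intro A B C _ _ _ α _ hAC hBC hA hB
  obtain ⟨v, -, hv, hS⟩ := h (A ∪ B ∪ C) A B α (fun x hx => Or.inl (Or.inl hx))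
    (fun x hx => Or.inl (Or.inr hx)) hA hB
  refine ⟨v, hv, fun a ha => (hS a (Or.inl (Or.inl ha))).1.2 ha,
    fun b hb => (hS b (Or.inl (Or.inr hb))).2.2 hb, fun c hc => ?_⟩
  have hS := hS c (Or.inr hc)
  exact ⟨fun h => hAC.notMem_of_mem_left (hS.1.1 h) hc,
    fun h => hBC.notMem_of_mem_left (hS.2.1 h) hc⟩

/-- A number has representations of arbitrarily large rank. -/
theorem Rep.exists_value_eq_of_lt {x w : Rep.{u}} (h : x.value < w.value) :
    ∃ y : Rep.{u}, y.value = x.value ∧ w.1.rank < y.1.rank := by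
  -- Since `x < w`, the extra right option `w` leaves the value unchanged but forces the rank above
  -- that of `w`.
  obtain ⟨y, hl, hr⟩ := exists_left_right x.left (insert w x.right) (by
    rintro a ha b (rfl | hb)
    · exact (value_lt_of_mem_left ha).trans h
    · exact (value_lt_of_mem_left ha).trans (value_lt_of_mem_right hb))
  refine ⟨y, value_eq_of_cofinal ?_ ?_ ?_ ?_, rank_lt_of_mem_right (hr ▸ Set.mem_insert _ _)⟩
  · exact fun a ha => value_lt_of_mem_left (hl ▸ ha)
  · intro b hb
    rw [hr] at hb
    rcases hb with rfl | hb
    exacts [h, value_lt_of_mem_right hb]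
  · exact fun a ha => ⟨a, hl ▸ ha, le_rfl⟩
  · exact fun b hb => ⟨b, hr ▸ Set.mem_insert_of_mem _ hb, le_rfl⟩

/-- Every number has a representation with prescribed relations to a small set of representations. -/
theorem Rep.exists_value_eq_of_subset {S A B : Set Rep.{u}} [Small.{u} S] {x : Rep.{u}}
    (hAS : A ⊆ S) (hBS : B ⊆ S) (hA : ∀ a ∈ A, a.value < x.value)
    (hB : ∀ b ∈ B, x.value < b.value) : ∃ v : Rep.{u}, v ∉ S ∧ v.value = x.value ∧
      ∀ s ∈ S, (s ∈ v.left ∨ v ∈ s.right ↔ s ∈ A) ∧ (v ∈ s.left ∨ s ∈ v.right ↔ s ∈ B) := by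
  have : Small.{u} A := small_subset hAS
  have : Small.{u} B := small_subset hBS
  -- `w` exceeds `x`, its options and all of `S`, both in value and in rank.
  obtain ⟨w, hwl, -⟩ := Rep.exists_left_right (insert x (S ∪ (x.left ∪ x.right))) ∅ (by simp)
  have hw : ∀ y ∈ insert x (S ∪ (x.left ∪ x.right)), y ∈ w.left := fun y hy => hwl ▸ hy
  have hcopy : ∀ y : Rep.{u}, ∃ z : Rep.{u}, y ∈ w.left → z.value = y.value ∧
      w.1.rank < z.1.rank := fun y => by
    by_cases hy : y ∈ w.left
    · obtain ⟨z, hz⟩ := Rep.exists_value_eq_of_lt (Rep.value_lt_of_mem_left hy)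
      exact ⟨z, fun _ => hz⟩
    · exact ⟨y, fun h => absurd h hy⟩
  -- `f` copies the options of `x` to rank above `w`, hence outside `S`: as options of `v` they
  -- create no unwanted edges with `S`.
  choose f hf using hcopy
  have hL : ∀ y ∈ x.left, (f y).value = y.value ∧ w.1.rank < (f y).1.rank :=
    fun y hy => hf y (hw y (Or.inr (Or.inr (Or.inl hy))))
  have hR : ∀ y ∈ x.right, (f y).value = y.value ∧ w.1.rank < (f y).1.rank :=
    fun y hy => hf y (hw y (Or.inr (Or.inr (Or.inr hy))))
  have hxw : x.value < w.value := Rep.value_lt_of_mem_left (hw x (Or.inl rfl))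
  have hl : ∀ a ∈ A ∪ f '' x.left, a.value < x.value := by
    rintro a (ha | ⟨y, hy, rfl⟩)
    · exact hA a ha
    · exact (hL y hy).1 ▸ Rep.value_lt_of_mem_left hy
  have hr : ∀ b ∈ insert w (B ∪ f '' x.right), x.value < b.value := by
    rintro b (rfl | hb | ⟨y, hy, rfl⟩)
    · exact hxw
    · exact hB b hb
    · exact (hR y hy).1 ▸ Rep.value_lt_of_mem_right hy
  -- The right option `w` puts the rank of `v` above `S`, so `v` is neither in `S` nor an option of
  -- a node in `S`.
  obtain ⟨v, hvl, hvr⟩ := Rep.exists_left_right (A ∪ f '' x.left) (insert w (B ∪ f '' x.right))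
    fun a ha b hb => (hl a ha).trans (hr b hb)
  have hSw : ∀ s ∈ S, s.1.rank < w.1.rank :=
    fun s hs => Rep.rank_lt_of_mem_left (hw s (Or.inr (Or.inl hs)))
  have hSv : ∀ s ∈ S, s.1.rank < v.1.rank := fun s hs =>
    (hSw s hs).trans (Rep.rank_lt_of_mem_right (hvr ▸ Set.mem_insert _ _))
  refine ⟨v, fun h => (hSv v h).false, Rep.value_eq_of_cofinal (hvl ▸ hl) (hvr ▸ hr) ?_ ?_,
    fun s hs => ⟨⟨?_, fun h => Or.inl ?_⟩, ⟨?_, fun h => Or.inr ?_⟩⟩⟩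
  · exact fun a ha => ⟨f a, hvl ▸ Or.inr ⟨a, ha, rfl⟩, (hL a ha).1.ge⟩
  · exact fun b hb => ⟨f b, hvr ▸ Or.inr (Or.inr ⟨b, hb, rfl⟩), (hR b hb).1.le⟩
  · rintro (h | h)
    · rw [hvl] at h
      rcases h with h | ⟨y, hy, rfl⟩
      · exact h
      · exact absurd (hL y hy).2 (hSw _ hs).not_gt
    · exact absurd (rank_lt_of_mem_right h) (hSv s hs).not_gt
  · exact hvl ▸ Or.inl h
  · rintro (h | h)
    · exact absurd (rank_lt_of_mem_left h) (hSv s hs).not_gt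
    · rw [hvr] at h
      rcases h with rfl | h | ⟨y, hy, rfl⟩
      · exact absurd (hSw _ hs) (lt_irrefl _)
      · exact h
      · exact absurd (hR y hy).2 (hSw _ hs).not_gt
  · exact hvr ▸ Or.inr (Or.inl h)

theorem setExtension_Hg : SetExtension Hg.{u} := by
  intro S A B hS α hAS hBS hA hB
  obtain ⟨x, rfl⟩ := Rep.exists_value_eq α
  exact @Rep.exists_value_eq_of_subset S A B hS x hAS hBS hA hB

/-- A universal and set-homogeneous graded digraph has the extension property. -/
theorem SetUniversal.setExtension {H : GradedDigraph.{u + 1} No.{u}} (hU : SetUniversal H)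
    (hH : SetHomogeneous H) : SetExtension H := by
  intro S A B _ α _ _ hA hB
  let p : Shrink.{u} S → H.V := fun i => ((equivShrink S).symm i).1
  -- `G` is the subgraph induced on `S` with one added node `none` having the desired value and
  -- edges.
  let G : GradedDigraph.{u} (Set.univ : Set No.{u}) :=
    { V := Option (Shrink.{u} S)
      Adj := fun i j => match i, j with
        | some i, some j => H.Adj (p i) (p j)
        | some i, none => p i ∈ A
        | none, some j => p j ∈ B
        | none, none => False
      val := fun i => ⟨i.elim α fun i => H.val (p i), trivial⟩
      val_lt := fun {i j} h => match i, j, h with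
        | some _, some _, h => H.val_lt h
        | some _, none, h => hA _ h
        | none, some _, h => hB _ h }
  obtain ⟨e⟩ := hU _ G
  let T : Set H.V := Set.range fun i : Shrink.{u} S => e.toFun (some i)
  have he : Function.Injective fun i : Shrink.{u} S => e.toFun (some i) :=
    e.injective.comp (Option.some_injective _)
  let q : Shrink.{u} S ≃ T := Equiv.ofInjective _ he
  let φ : T ≃ S := q.symm.trans (equivShrink S).symm
  have hφ : ∀ i, (φ (q i)).1 = p i := fun i => by simp [φ, p]
  -- The embedding may move `S` to another copy `T`. Homogeneity carries `T` back to `S`, and the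
  -- image of `none` becomes the required node.
  obtain ⟨F, hF⟩ := hH T S
    { toEquiv := φ
      adj_iff := fun a b => by
        obtain ⟨i, rfl⟩ := q.surjective a
        obtain ⟨j, rfl⟩ := q.surjective b
        change H.Adj (φ (q i)).1 (φ (q j)).1 ↔ _
        rw [hφ, hφ]
        exact (e.adj_iff (some i) (some j)).symm
      val_eq := fun a => by
        obtain ⟨i, rfl⟩ := q.surjective a
        change H.val (φ (q i)).1 = _
        rw [hφ]
        exact (e.val_eq (some i)).symm }
  have hF' : ∀ s ∈ S, ∃ i, p i = s ∧ F.toEquiv (e.toFun (some i)) = s := fun s hs => by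
    have hp : p (equivShrink S ⟨s, hs⟩) = s := by simp [p]
    exact ⟨_, hp, ((hF (q _)).trans (hφ _)).trans hp⟩
  refine ⟨F.toEquiv (e.toFun none), fun h => ?_, ?_, fun s hs => ?_⟩
  · obtain ⟨i, -, hi⟩ := hF' _ h
    exact absurd (e.injective (F.toEquiv.injective hi)) (by simp)
  · rw [F.val_eq, e.val_eq]
    rfl
  · obtain ⟨i, hi, hi'⟩ := hF' s hs
    have h1 := e.adj_iff (some i) none
    have h2 := e.adj_iff none (some i)
    rw [← F.adj_iff, hi'] at h1 h2
    rw [h1, h2, ← hi]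
    exact ⟨Iff.rfl, Iff.rfl⟩

/-! ### Transfinite recursion along well-orders with small initial segments -/

/-- Choose values one after another, such that each is compatible with the earlier ones. -/
theorem exists_forall_compatible {α : Type v} {β : Type w} [Nonempty β] (r : α → α → Prop) [IsWellOrder α r]
    (P : α → β → Prop) (C : α → β → α → β → Prop)
    (hC : ∀ a b a' b', C a b a' b' → C a' b' a b)
    (ext : ∀ (a : α) (g : α → β), (∀ x, r x a → P x (g x)) →
      (∀ x y, r x a → r y a → x ≠ y → C x (g x) y (g y)) →
      ∃ b, P a b ∧ ∀ x, r x a → C x (g x) a b) :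
    ∃ g : α → β, (∀ a, P a (g a)) ∧ ∀ x y, x ≠ y → C x (g x) y (g y) := by
  have wf : WellFounded r := IsWellFounded.wf
  -- `epsilon` makes the recursion total; that a suitable value exists at each stage is proved
  -- afterwards by induction.
  let g : α → β := wf.fix fun a ih =>
    Classical.epsilon fun b => P a b ∧ ∀ x (hx : r x a), C x (ih x hx) a b
  have hg : ∀ a, g a = Classical.epsilon fun b => P a b ∧ ∀ x, r x a → C x (g x) a b :=
    fun a => wf.fix_eq _ a
  have key : ∀ a, P a (g a) ∧ ∀ x, r x a → C x (g x) a (g a) := by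
    intro a
    induction a using wf.induction with
    | _ a ih =>
    rw [hg a]
    refine Classical.epsilon_spec (ext a g (fun x hx => (ih x hx).1) fun x y hx hy hxy => ?_)
    -- Compatibility of two earlier choices is known at the later of the two, whence the symmetry
    -- assumption on `C`.
    rcases trichotomous_of r x y with h | h | h
    · exact (ih y hy).2 x h
    · exact absurd h hxy
    · exact hC _ _ _ _ ((ih x hx).2 y h)
  refine ⟨g, fun a => (key a).1, fun x y hxy => ?_⟩
  rcases trichotomous_of r x y with h | h | h
  · exact (key y).2 x h
  · exact absurd h hxy
  · exact hC _ _ _ _ ((key x).2 y h)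

/-- A class has a well-order all of whose initial segments are sets. -/
theorem IsClassSized.exists_wellOrder {α : Type v} (h : IsClassSized.{u} α) :
    ∃ r : α → α → Prop, IsWellOrder α r ∧ ∀ a, Small.{u} {x | r x a} := by
  obtain ⟨f⟩ := h
  let g : α ↪ Ordinal.{u} × α := ⟨fun a => ((f a).rank, a), fun a b h => congrArg Prod.snd h⟩
  -- Ordering by rank first places the predecessors of `a` in the von Neumann stage just above the
  -- rank of `f a`, which is a set.
  let r : α → α → Prop := g ⁻¹'o Prod.Lex (· < ·) WellOrderingRel
  refine ⟨r, (RelEmbedding.preimage g _).isWellOrder, fun a => ?_⟩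
  refine small_of_injective (β := ZFSet.vonNeumann (Order.succ (f a).rank))
    (f := fun x => ⟨f x.1, ?_⟩) fun x y hxy =>
      Subtype.ext (f.injective (congrArg Subtype.val hxy))
  rw [ZFSet.mem_vonNeumann, Order.lt_succ_iff]
  rcases Prod.lex_iff.1 x.2 with h | h
  exacts [h.le, h.1.le]

/-- Tagging keeps the two images disjoint. The sum indexes the back-and-forth, which enumerates the
nodes of both digraphs together. -/
theorem IsClassSized.sum {α : Type v} {β : Type w} (hα : IsClassSized.{u} α)
    (hβ : IsClassSized.{u} β) : IsClassSized.{u} (α ⊕ β) := by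
  obtain ⟨f⟩ := hα
  obtain ⟨g⟩ := hβ
  refine ⟨⟨Sum.elim (fun a => ZFSet.pair (f a) ∅) fun b => ZFSet.pair (g b) {∅}, ?_⟩⟩
  have h : (∅ : ZFSet.{u}) ≠ {∅} := fun h =>
    ZFSet.notMem_empty _ ((ZFSet.ext_iff.1 h ∅).2 (ZFSet.mem_singleton.2 rfl))
  rintro (a | a) (b | b) hab <;> simp only [Sum.elim_inl, Sum.elim_inr, ZFSet.pair_inj] at hab
  · exact congrArg Sum.inl (f.injective hab.1)
  · exact absurd hab.2 h
  · exact absurd hab.2.symm h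
  · exact congrArg Sum.inr (g.injective hab.1)

/-! ### Back and forth -/

namespace GradedDigraph

/-- The two pairs `p` and `q` of nodes are part of a partial isomorphism from `H` to `K`. -/
def Compatible (H : GradedDigraph.{v} No.{u}) (K : GradedDigraph.{w} No.{u})
    (p q : H.V × K.V) : Prop :=
  (p.1 = q.1 ↔ p.2 = q.2) ∧ (H.Adj p.1 q.1 ↔ K.Adj p.2 q.2) ∧ (H.Adj q.1 p.1 ↔ K.Adj q.2 p.2)

variable {H : GradedDigraph.{v} No.{u}} {K : GradedDigraph.{w} No.{u}}

theorem not_adj_self (H : GradedDigraph.{v} No.{u}) (x : H.V) : ¬ H.Adj x x :=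
  fun h => (H.val_lt h).false

theorem Compatible.refl (p : H.V × K.V) : Compatible H K p p :=
  ⟨iff_of_true rfl rfl, iff_of_false (H.not_adj_self _) (K.not_adj_self _),
    iff_of_false (H.not_adj_self _) (K.not_adj_self _)⟩

theorem Compatible.symm {p q : H.V × K.V} (h : Compatible H K p q) : Compatible H K q p :=
  ⟨eq_comm.trans (h.1.trans eq_comm), h.2.2, h.2.1⟩

theorem Compatible.swap {p q : H.V × K.V} (h : Compatible H K p q) :
    Compatible K H p.swap q.swap :=
  ⟨h.1.symm, h.2.1.symm, h.2.2.symm⟩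

end GradedDigraph

open GradedDigraph

theorem SetExtension.nonempty {K : GradedDigraph.{u + 1} No.{u}} (hK : SetExtension K) :
    Nonempty K.V := by
  obtain ⟨α, -⟩ := No.exists_between.{u} ∅ ∅ (by simp)
  obtain ⟨v, -⟩ := hK ∅ ∅ ∅ α subset_rfl subset_rfl (by simp) (by simp)
  exact ⟨v⟩

/-- Small partial isomorphisms into a graded digraph with the extension property can be extended
to one more node. -/
theorem SetExtension.exists_compatible {H : GradedDigraph.{v} No.{u}}
    {K : GradedDigraph.{u + 1} No.{u}} (hK : SetExtension K) (D : Set (H.V × K.V)) [Small.{u} D]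
    (hD : ∀ p ∈ D, ∀ q ∈ D, Compatible H K p q) (hval : ∀ p ∈ D, H.val p.1 = K.val p.2) (x : H.V) :
    ∃ y, H.val x = K.val y ∧ ∀ p ∈ D, Compatible H K p (x, y) := by
  by_cases hx : ∃ q ∈ D, q.1 = x
  · obtain ⟨q, hq, rfl⟩ := hx
    exact ⟨q.2, hval q hq, fun p hp => hD p hp q hq⟩
  -- The edges of `x` to the domain are transported along `D`; `y` must avoid the range because `x`
  -- is outside the domain.
  obtain ⟨y, hyS, hy, h⟩ := hK (Prod.snd '' D) (Prod.snd '' {p ∈ D | H.Adj p.1 x})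
    (Prod.snd '' {p ∈ D | H.Adj x p.1}) (H.val x) (Set.image_mono fun _ h => h.1)
    (Set.image_mono fun _ h => h.1)
    (by rintro _ ⟨p, hp, rfl⟩; exact hval p hp.1 ▸ H.val_lt hp.2)
    (by rintro _ ⟨p, hp, rfl⟩; exact hval p hp.1 ▸ H.val_lt hp.2)
  refine ⟨y, hy.symm, fun p hp => ⟨?_, ?_, ?_⟩⟩
  · exact iff_of_false (fun h => hx ⟨p, hp, h⟩) fun h => hyS ⟨p, hp, h⟩
  · refine Iff.trans ⟨fun h => ⟨p, ⟨hp, h⟩, rfl⟩, ?_⟩ (h p.2 ⟨p, hp, rfl⟩).1.symm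
    rintro ⟨q, hq, hqp⟩
    -- `D` is injective, so an edge prescribed through `q` is one for `p`.
    exact (hD q hq.1 p hp).1.2 hqp ▸ hq.2
  · refine Iff.trans ⟨fun h => ⟨p, ⟨hp, h⟩, rfl⟩, ?_⟩ (h p.2 ⟨p, hp, rfl⟩).2.symm
    rintro ⟨q, hq, hqp⟩
    exact (hD q hq.1 p hp).1.2 hqp ▸ hq.2

/-- Graded digraphs that can be enumerated with small initial segments embed in all graded digraphs
with the extension property. -/
theorem SetExtension.nonempty_embedding {K : GradedDigraph.{u + 1} No.{u}} (hK : SetExtension K)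
    {s : Set No.{u}} (G : GradedDigraph.{v} s) (r : G.V → G.V → Prop) [IsWellOrder G.V r]
    (hr : ∀ a, Small.{u} {x | r x a}) : Nonempty (G.Embedding K) := by
  have := hK.nonempty
  -- `G` regraded by all of `No`, so that values on both sides can be compared.
  let H : GradedDigraph.{v} No.{u} := ⟨G.V, G.Adj, fun x => G.val x, fun h => G.val_lt h⟩
  obtain ⟨g, hg, hg'⟩ := exists_forall_compatible (β := K.V) r (fun x y => H.val x = K.val y)
    (fun x y x' y' => Compatible H K (x, y) (x', y')) (fun _ _ _ _ h => h.symm) (by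
      intro a g hP hC
      have := hr a
      obtain ⟨y, hy, h⟩ := hK.exists_compatible (H := H) ((fun x => (x, g x)) '' {x | r x a}) (by
          rintro _ ⟨x, hx, rfl⟩ _ ⟨x', hx', rfl⟩
          by_cases hxx : x = x'
          · exact hxx ▸ Compatible.refl _
          · exact hC x x' hx hx' hxx) (by
          rintro _ ⟨x, hx, rfl⟩
          exact hP x hx) a
      exact ⟨y, hy, fun x hx => h _ ⟨x, hx, rfl⟩⟩)
  have hC : ∀ x y, Compatible H K (x, g x) (y, g y) := fun x y => by
    by_cases hxy : x = y
    · exact hxy ▸ Compatible.refl _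
    · exact hg' x y hxy
  exact ⟨⟨g, fun x y h => (hC x y).1.2 h, fun x y => (hC x y).2.1.symm, fun x => (hg x).symm⟩⟩

/-- Small partial isomorphisms between class-sized graded digraphs with the extension property
extend to isomorphisms. -/
theorem SetExtension.exists_iso {H K : GradedDigraph.{u + 1} No.{u}} (hH : SetExtension H)
    (hK : SetExtension K) (hH' : IsClassSized.{u} H.V) (hK' : IsClassSized.{u} K.V)
    (D : Set (H.V × K.V)) [Small.{u} D] (hD : ∀ p ∈ D, ∀ q ∈ D, Compatible H K p q)
    (hval : ∀ p ∈ D, H.val p.1 = K.val p.2) :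
    ∃ F : H.Iso K, ∀ p ∈ D, F.toEquiv p.1 = p.2 := by
  have := hH.nonempty
  have := hK.nonempty
  obtain ⟨r, _, hr⟩ := (hH'.sum hK').exists_wellOrder
  -- Stage `i` chooses a whole pair containing the node `i`: `inl` stages go forth, `inr` stages go
  -- back. Every pair is also kept compatible with `D`.
  obtain ⟨g, hg, hg'⟩ := exists_forall_compatible (β := H.V × K.V) r
    (fun i p => H.val p.1 = K.val p.2 ∧ (∀ q ∈ D, Compatible H K q p) ∧
      i.elim (· = p.1) (· = p.2))
    (fun _ p _ q => Compatible H K p q) (fun _ _ _ _ h => h.symm) (by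
      intro i g hP hC
      have := hr i
      let E : Set (H.V × K.V) := D ∪ g '' {x | r x i}
      have hE : ∀ p ∈ E, ∀ q ∈ E, Compatible H K p q := by
        rintro _ (hp | ⟨x, hx, rfl⟩) _ (hq | ⟨y, hy, rfl⟩)
        · exact hD _ hp _ hq
        · exact (hP y hy).2.1 _ hp
        · exact ((hP x hx).2.1 _ hq).symm
        · by_cases hxy : x = y
          · exact hxy ▸ Compatible.refl _
          · exact hC x y hx hy hxy
      have hE_val : ∀ p ∈ E, H.val p.1 = K.val p.2 := by
        rintro _ (hp | ⟨x, hx, rfl⟩)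
        exacts [hval _ hp, (hP x hx).1]
      rcases i with x | y
      · obtain ⟨y, hy, h⟩ := hK.exists_compatible E hE hE_val x
        exact ⟨(x, y), ⟨hy, fun q hq => h q (Or.inl hq), rfl⟩,
          fun j hj => h _ (Or.inr ⟨j, hj, rfl⟩)⟩
      · obtain ⟨x, hx, h⟩ := hH.exists_compatible (Prod.swap '' E) (by
          rintro _ ⟨p, hp, rfl⟩ _ ⟨q, hq, rfl⟩
          exact (hE p hp q hq).swap) (by
          rintro _ ⟨p, hp, rfl⟩
          exact (hE_val p hp).symm) y
        have h : ∀ p ∈ E, Compatible H K p (x, y) := fun p hp => (h _ ⟨p, hp, rfl⟩).swap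
        exact ⟨(x, y), ⟨hx.symm, fun q hq => h q (Or.inl hq), rfl⟩,
          fun j hj => h _ (Or.inr ⟨j, hj, rfl⟩)⟩)
  have hC : ∀ i j, Compatible H K (g i) (g j) := fun i j => by
    by_cases hij : i = j
    · exact hij ▸ Compatible.refl _
    · exact hg' i j hij
  have h1 : ∀ x, x = (g (Sum.inl x)).1 := fun x => (hg (Sum.inl x)).2.2
  have h2 : ∀ y, y = (g (Sum.inr y)).2 := fun y => (hg (Sum.inr y)).2.2
  -- The chosen pairs are mutually compatible and cover both sides, so they form the graph of a
  -- bijection.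
  refine ⟨⟨⟨fun x => (g (Sum.inl x)).2, fun y => (g (Sum.inr y)).1, fun x => ?_, fun y => ?_⟩,
    fun x y => ?_, fun x => ?_⟩, fun p hp => ?_⟩
  · exact ((hC _ _).1.2 (h2 _).symm).trans (h1 x).symm
  · exact ((hC _ _).1.1 (h1 _).symm).trans (h2 y).symm
  · have h := (hC (Sum.inl x) (Sum.inl y)).2.1
    rw [← h1, ← h1] at h
    exact h.symm
  · have h := (hg (Sum.inl x)).1
    rw [← h1] at h
    exact h.symm
  · exact (((hg (Sum.inl p.1)).2.1 p hp).1.1 (h1 _)).symm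

/-- Back-and-forth from `H` to itself, starting from the graph of the given partial isomorphism. -/
theorem SetExtension.setHomogeneous {H : GradedDigraph.{u + 1} No.{u}} (hH : SetExtension H)
    (hH' : IsClassSized.{u} H.V) : SetHomogeneous H := by
  intro S T _ _ f
  let φ : S → T := f.toEquiv
  obtain ⟨F, hF⟩ := hH.exists_iso hH hH' hH' (Set.range fun x : S => (x.1, (φ x).1)) (by
    rintro _ ⟨x, rfl⟩ _ ⟨y, rfl⟩
    exact ⟨Subtype.ext_iff.symm.trans (f.toEquiv.injective.eq_iff.symm.trans Subtype.ext_iff),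
      (f.adj_iff x y).symm, (f.adj_iff y x).symm⟩) (by
    rintro _ ⟨x, rfl⟩
    exact (f.val_eq x).symm)
  exact ⟨F, fun x => hF _ ⟨x, rfl⟩⟩

/-- Linear orders that can be enumerated with small initial segments embed in the surreals. -/
theorem No.nonempty_orderEmbedding {ℓ : Type v} [LinearOrder ℓ] (r : ℓ → ℓ → Prop)
    [IsWellOrder ℓ r] (hr : ∀ a, Small.{u} {x | r x a}) : Nonempty (ℓ ↪o No.{u}) := by
  have : Nonempty No.{u} := ⟨(No.exists_between.{u} ∅ ∅ (by simp)).choose⟩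
  obtain ⟨g, -, hg⟩ := exists_forall_compatible (β := No.{u}) r (fun _ _ => True)
    (fun x a y b => (x < y → a < b) ∧ (y < x → b < a)) (fun _ _ _ _ h => h.symm) (by
      intro a g _ hC
      have := hr a
      -- The earlier elements below and above `a` give a small cut in `No`, and `b` fills it.
      obtain ⟨b, hA, hB⟩ := No.exists_between (g '' ({x | r x a} ∩ {x | x < a}))
        (g '' ({x | r x a} ∩ {x | a < x})) (by
          rintro _ ⟨x, hx, rfl⟩ _ ⟨y, hy, rfl⟩
          have hxy : x < y := hx.2.trans hy.2
          exact (hC x y hx.1 hy.1 hxy.ne).1 hxy)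
      exact ⟨b, trivial, fun x hx => ⟨fun h => hA _ ⟨x, ⟨hx, h⟩, rfl⟩,
        fun h => hB _ ⟨x, ⟨hx, h⟩, rfl⟩⟩⟩)
  exact ⟨OrderEmbedding.ofStrictMono g fun x y h => (hg x y h.ne).1 h⟩

theorem isClassSized_Hg : IsClassSized.{u} Hg.{u}.V :=
  ⟨⟨Subtype.val, Subtype.val_injective⟩⟩

end Hypnagogic

theorem mainTheorem11 :
    -- the nodes form a class
    Hypnagogic.IsClassSized.{u} Hypnagogic.Hg.{u}.V ∧
    -- every set linear order is a suborder of `No`, and `Hg` is universal for set graded digraphs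
    ((∀ (ℓ : Type u) [LinearOrder ℓ], Nonempty (ℓ ↪o Hypnagogic.No.{u})) ∧
      Hypnagogic.SetUniversal Hypnagogic.Hg.{u}) ∧
    Hypnagogic.SetHomogeneous Hypnagogic.Hg.{u} ∧
    -- under global choice: the same for class linear orders and class graded digraphs, and
    -- `Hg` is the only universal and set-homogeneous class digraph graded by `No`
    (Hypnagogic.GlobalChoice.{u} →
      ((∀ (ℓ : Type (u + 1)) [LinearOrder ℓ], Hypnagogic.IsClassSized.{u} ℓ →
          Nonempty (ℓ ↪o Hypnagogic.No.{u})) ∧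
        Hypnagogic.ClassUniversal Hypnagogic.Hg.{u}) ∧
      ∀ H : Hypnagogic.GradedDigraph.{u + 1} Hypnagogic.No.{u}, Hypnagogic.IsClassSized.{u} H.V →
        Hypnagogic.SetUniversal H → Hypnagogic.SetHomogeneous H →
        Nonempty (H.Iso Hypnagogic.Hg.{u})) ∧
    Hypnagogic.SetPattern Hypnagogic.Hg.{u} := by
  open Hypnagogic in
  have hHg := setExtension_Hg.{u}
  refine ⟨isClassSized_Hg, ⟨fun ℓ _ => ?_, fun s G => ?_⟩, hHg.setHomogeneous isClassSized_Hg,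
    fun _ => ⟨⟨fun ℓ _ hℓ => ?_, fun s G hG => ?_⟩, fun H hH hU hH' => ?_⟩, hHg.setPattern⟩
  · exact No.nonempty_orderEmbedding WellOrderingRel fun a => inferInstance
  · exact hHg.nonempty_embedding G WellOrderingRel fun a => inferInstance
  · obtain ⟨r, _, hr⟩ := hℓ.exists_wellOrder
    exact No.nonempty_orderEmbedding r hr
  · obtain ⟨r, _, hr⟩ := hG.exists_wellOrder
    exact hHg.nonempty_embedding G r hr
  · obtain ⟨F, -⟩ := (hU.setExtension hH').exists_iso hHg hH isClassSized_Hg ∅ (by simp) (by simp)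
    exact ⟨F⟩
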